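/- **Setting.** For a prior $\pi$ (a Borel probability measure) on $[0,\theta_{\max}]$ let $\theta_1,\dots,\theta_n$ be i.i.d. from $\pi$ and, given these, let $X_i\sim\mathrm{Poi}(\theta_i)$ independently. Let $\hat\theta_\pi(x)=\mathbb E[\theta\mid X=x]$ be the Bayes estimator and $\mathsf{mmse}(\pi)=\mathbb E[(\hat\theta_\pi(X)-\theta)^2]$, where $(\theta,X)$ is distributed as $(\theta_1,X_1)$. An estimator $T$ maps $(X_1,\dots,X_n)$ to $(T_1,\dots,T_n)\in\mathbb R^n$; its regret at coordinate $i$ is $$\mathsf{Regret}_{\pi,i}(T)=\mathbb E\big[(T_i(X_1,\dots,X_n)-\theta_i)^2\big]-\mathsf{mmse}(\pi).$$ A *transformer* $\Gamma$ maps sequences $(x_1,\dots,x_n)\in\mathbb N^n$ of arbitrary length to $\mathbb R^n$, with the same parameters for every $n$, as follows. (i) Embedding: tokens $0,\dots,v-1$ are sent to the rows of a matrix $E\in\mathbb R^{v\times m}$ and tokens $\ge v$ to $0$, giving $H\in\mathbb R^{n\times m}$. (ii) Finitely many encoder layers, each of which replaces $H$ by $H'=H+\sum_h \mathrm{softmax}\big(HW_Q^h(HW_K^h)^\top/\sqrt{d_k}\big)HW_V^hW_O^h$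 (multi-head softmax attention with a skip connection, softmax taken row-wise) and then $H'$ by $H'+\mathrm{ReLU}(H'W_1+b_1)W_2+b_2$, where the row vectors $b_1,b_2$ are added to every row (token-wise feedforward network with one hidden layer and a skip connection). (iii) A linear decoder $H\mapsto Hw+b\in\mathbb R^n$ with $w\in\mathbb R^m$, $b\in\mathbb R$ ($b$ added to every entry). There is no positional encoding, masking or layer normalization. The number of parameters is the total number of entries of all these matrices and vectors. **Statement.** Fix $\theta_{\max}>0$. For every $\varepsilon>0$ there are an integer $N=N(\varepsilon)\ge 0$ and a transformer $\Gamma=\Gamma_\varepsilon$ such that for all $n\ge N$ and all $1\le i\le n$, $(\Gamma(X_1,\dots,X_n)_i-\theta_i)^2$ is integrable for every prior $\pi$ on $[0,\theta_{\max}]$, and $$\sup_{\pi\in\mathcal P([0,\theta_{\max}])}\mathsf{Regret}_{\pi,i}\big(\Gamma(X_1,\dots,X_n)\big)\le\varepsilon,$$ and these can be chosen so that, as $\varepsilon\to0^+$, $N(\varepsilon)=O_{\theta_{\max}}\big(\varepsilon^{-1}\log^2(\varepsilon^{-1})\big)$ and $\Gamma_\varepsilon$ has $O_{\theta_{\max}}(\varepsilon^{-1})$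 parameters. -/

import Mathlib

open MeasureTheory ProbabilityTheory Filter Topology Asymptotics
open scoped NNReal ENNReal Matrix

noncomputable section

namespace PoissonEB

/-! ### Transformers

Full-attention, encoder-only transformers without positional encoding or masking, acting on
finite sequences of natural numbers of arbitrary length. A sequence of `n` hidden states of
dimension `m` is an `n × m` matrix whose rows are the states. -/

/-- Row-wise softmax of a square matrix of attention scores. -/
def softmax {n : ℕ} (S : Matrix (Fin n) (Fin n) ℝ) : Matrix (Fin n) (Fin n) ℝ :=
  Matrix.of fun i j => Real.exp (S i j) / ∑ l, Real.exp (S i l)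

/-- Scaled dot-product attention `softmax (Q Kᵀ / √dₖ) V`. -/
def attention {n dk dv : ℕ} (Q K : Matrix (Fin n) (Fin dk) ℝ) (V : Matrix (Fin n) (Fin dv) ℝ) :
    Matrix (Fin n) (Fin dv) ℝ :=
  softmax ((1 / Real.sqrt dk) • (Q * Kᵀ)) * V

/-- One encoder layer on hidden states of dimension `m`: the weights of a multi-head attention
(`heads` heads with key dimension `dk` and value dimension `dv`; the matrices `WO h` are the
blocks of the output projection) and of a feedforward network with `width` hidden neurons. -/
structure EncoderLayer (m : ℕ) where
  heads : ℕ
  dk : ℕ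
  dv : ℕ
  width : ℕ
  WQ : Fin heads → Matrix (Fin m) (Fin dk) ℝ
  WK : Fin heads → Matrix (Fin m) (Fin dk) ℝ
  WV : Fin heads → Matrix (Fin m) (Fin dv) ℝ
  WO : Fin heads → Matrix (Fin dv) (Fin m) ℝ
  W₁ : Matrix (Fin m) (Fin width) ℝ
  b₁ : Fin width → ℝ
  W₂ : Matrix (Fin width) (Fin m) ℝ
  b₂ : Fin m → ℝ

namespace EncoderLayer

variable {m : ℕ}

/-- Multi-head self-attention followed by a skip connection. -/
def attend (B : EncoderLayer m) {n : ℕ} (H : Matrix (Fin n) (Fin m) ℝ) :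
    Matrix (Fin n) (Fin m) ℝ :=
  H + ∑ h, attention (H * B.WQ h) (H * B.WK h) (H * B.WV h) * B.WO h

/-- Token-wise feedforward network with ReLU activation, followed by a skip connection. -/
def feedForward (B : EncoderLayer m) {n : ℕ} (H : Matrix (Fin n) (Fin m) ℝ) :
    Matrix (Fin n) (Fin m) ℝ :=
  Matrix.of fun i j =>
    H i j + (∑ k, max ((∑ l, H i l * B.W₁ l k) + B.b₁ k) 0 * B.W₂ k j + B.b₂ j)

/-- The map computed by one encoder layer. -/
def apply (B : EncoderLayer m) {n : ℕ} (H : Matrix (Fin n) (Fin m) ℝ) :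
    Matrix (Fin n) (Fin m) ℝ :=
  B.feedForward (B.attend H)

/-- The number of real parameters (matrix and bias entries) of a layer. -/
def numParams (B : EncoderLayer m) : ℕ :=
  B.heads * (m * B.dk + m * B.dk + m * B.dv + B.dv * m) +
    (m * B.width + B.width + B.width * m + m)

end EncoderLayer

/-- A transformer: a token embedding table for the tokens `0, …, vocab - 1`, a list of encoder
layers, and a linear decoder which reads one real number from each hidden state. -/
structure Transformer where
  vocab : ℕ
  dmodel : ℕ
  embed : Matrix (Fin vocab) (Fin dmodel) ℝ
  layers : List (EncoderLayer dmodel)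
  decode : Fin dmodel → ℝ
  bias : ℝ

namespace Transformer

/-- The embedded input sequence; tokens outside the vocabulary are sent to the zero vector. -/
def embedInput (Γ : Transformer) {n : ℕ} (x : Fin n → ℕ) :
    Matrix (Fin n) (Fin Γ.dmodel) ℝ :=
  Matrix.of fun i j => if h : x i < Γ.vocab then Γ.embed ⟨x i, h⟩ j else 0

/-- The hidden states after all encoder layers; the head of the list is applied first. -/
def encode (Γ : Transformer) {n : ℕ} (x : Fin n → ℕ) : Matrix (Fin n) (Fin Γ.dmodel) ℝ :=
  Γ.layers.foldl (fun H B => B.apply H) (Γ.embedInput x)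

/-- The output `Γ(x₁, …, xₙ) ∈ ℝⁿ`, for an input of any length `n`. -/
def eval (Γ : Transformer) {n : ℕ} (x : Fin n → ℕ) : Fin n → ℝ :=
  fun i => ∑ j, Γ.encode x i j * Γ.decode j + Γ.bias

/-- The total number of real parameters. -/
def numParams (Γ : Transformer) : ℕ :=
  Γ.vocab * Γ.dmodel + (Γ.layers.map EncoderLayer.numParams).sum + (Γ.dmodel + 1)

end Transformer

/-! ### The Poisson empirical Bayes model -/

/-- The Markov kernel `θ ↦ Poi(θ)` (negative reals are sent to `Poi(0)`). -/
def poissonObs : Kernel ℝ ℕ where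
  toFun θ := poissonMeasure θ.toNNReal
  measurable' := by
    refine Measure.measurable_of_measurable_coe _ fun s _ => ?_
    simp only [poissonMeasure, Measure.sum_apply_of_countable, Measure.smul_apply, smul_eq_mul]
    fun_prop

instance : IsMarkovKernel poissonObs :=
  ⟨fun θ => inferInstanceAs (IsProbabilityMeasure (poissonMeasure θ.toNNReal))⟩

/-- The law of a pair `(θ, X)` with `θ ∼ π` and `X ∼ Poi(θ)` given `θ`. -/
def jointLaw (π : Measure ℝ) : Measure (ℝ × ℕ) := π ⊗ₘ poissonObs

/-- The law of `n` independent copies `(θ₁, X₁), …, (θₙ, Xₙ)` of the pair `(θ, X)`. -/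
def sampleLaw (π : Measure ℝ) (n : ℕ) : Measure (Fin n → ℝ × ℕ) :=
  Measure.pi fun _ => jointLaw π

/-- The Bayes estimator, i.e. the posterior mean `E[θ ∣ X = x]` under the prior `π`. -/
def bayesEstimator (π : Measure ℝ) (x : ℕ) : ℝ :=
  ∫ z, z.1 ∂(jointLaw π)[|{z : ℝ × ℕ | z.2 = x}]

/-- The Bayes risk `mmse(π) = E[(E[θ ∣ X] - θ)²]`. -/
def mmse (π : Measure ℝ) : ℝ :=
  ∫ z, (bayesEstimator π z.2 - z.1) ^ 2 ∂jointLaw π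

/-- The squared error at coordinate `i` of an estimator `T` of `(θ₁, …, θₙ)` from
`(X₁, …, Xₙ)`. -/
def sqLoss {n : ℕ} (T : (Fin n → ℕ) → Fin n → ℝ) (i : Fin n) (ω : Fin n → ℝ × ℕ) : ℝ :=
  (T (fun k => (ω k).2) i - (ω i).1) ^ 2

/-- The regret at coordinate `i`: the excess of the mean squared error
`E[(T(X₁, …, Xₙ)ᵢ - θᵢ)²]` over the Bayes risk. -/
def regret (π : Measure ℝ) {n : ℕ} (T : (Fin n → ℕ) → Fin n → ℝ) (i : Fin n) : ℝ :=
  (∫ ω, sqLoss T i ω ∂sampleLaw π n) - mmse π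

end PoissonEB

end

/-! For a Poisson mixture with marginal `f`, the identity `θ Poi(θ)(x) = (x + 1) Poi(θ)(x + 1)`
gives Robbins' formula `b(x) = (x + 1) f(x + 1) / f(x)` for the posterior mean. A single attention
layer can compute its empirical version. With one-hot queries and keys, equal tokens score `log r`
and all others `0`, so a position holding `x` sees `x + 1` with softmax weight `N(x + 1) / (r N(x) +
n - N(x))`. Multiplied by `r`, this is `N(x + 1) / N(x)` with the denominator regularized by `(n -
N(x)) / r`. ReLU neurons select the slot belonging to the token, multiply by `x + 1` and clip at `c
= θmax` (`robbinsTransformer_eval`).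

Given the other observations, the output is a function of `X_i` with values in `[0, c]`. By
Pythagoras (`integral_sq_sub_fst`) its excess risk is the `f`-weighted squared distance to `b`.
Values `x ≥ K` cost `O(e^{-K})` by a Chernoff bound. For `x < K`, the sum `(x + 1) N(x + 1) - b(x)
N(x)` is centred with variance `O(n f(x) (x + 1))`. Division by `(n f(x))²` and multiplication by
the weight `f(x)` cancel every power of `f(x)`, so the bound `O((x + 1) / n + 1 / r)` is uniform in
the prior (`marginal_mul_integral_sq_robbins_le`).

Summation gives a regret of `O(K² / n + K / r + e^{-K})`. With `K` of order `log ε⁻¹` and `r` of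
order `K / ε`, sample size `O(ε⁻¹ log² ε⁻¹)` suffices. The `O(K²)` parameters are well within
`O(ε⁻¹)`. -/

noncomputable section

namespace PoissonEB

/-! ### A one-layer transformer computing a regularized Robbins estimator -/

/-- The number of entries of `x` equal to `y`, as a real number. -/
def count {n : ℕ} (x : Fin n → ℕ) (y : ℕ) : ℝ := ∑ j, if x j = y then 1 else 0

/-- Coordinates of a hidden state: the one-hot encoding of the token, slots for the weighted
frequencies of the tokens `1, …, K`, and an output slot. -/
abbrev StateIdx (K : ℕ) : Type := Fin (K + 1) ⊕ Fin K ⊕ Unit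

/-- The enumeration of the coordinates of a hidden state. -/
def stateEquiv (K : ℕ) : Fin (Fintype.card (StateIdx K)) ≃ StateIdx K :=
  (Fintype.equivFin _).symm

/-- The enumeration of the hidden neurons of the feedforward network. -/
def neuronEquiv (K : ℕ) : Fin (Fintype.card (Fin K ⊕ Fin K)) ≃ Fin K ⊕ Fin K :=
  (Fintype.equivFin _).symm

/-- The hidden state with one-hot encoding of `t`, frequencies `u` and output `o`. -/
def mkState {K : ℕ} (t : ℕ) (u : Fin K → ℝ) (o : ℝ) : StateIdx K → ℝ :=
  Sum.elim (fun a => if t = a then 1 else 0) (Sum.elim u fun _ => o)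

/-- Query weights: the one-hot block, scaled so that equal tokens get the score `log r`. -/
def queryWeights (K : ℕ) (r : ℝ) : Matrix (Fin (Fintype.card (StateIdx K))) (Fin (K + 1)) ℝ :=
  Matrix.of fun j k => Sum.elim
    (fun a => if a = k then Real.log r * Real.sqrt ((K + 1 : ℕ) : ℝ) else 0)
    (fun _ => 0) (stateEquiv K j)

/-- Key weights: the one-hot block. -/
def keyWeights (K : ℕ) : Matrix (Fin (Fintype.card (StateIdx K))) (Fin (K + 1)) ℝ :=
  Matrix.of fun j k => Sum.elim (fun a => if a = k then 1 else 0) (fun _ => 0) (stateEquiv K j)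

/-- Value weights: the one-hot block without the token `0`. -/
def valueWeights (K : ℕ) : Matrix (Fin (Fintype.card (StateIdx K))) (Fin K) ℝ :=
  Matrix.of fun j k => Sum.elim (fun a => if a = k.succ then 1 else 0) (fun _ => 0)
    (stateEquiv K j)

/-- Output projection into the frequency slots, scaled by `r`. -/
def outputWeights (K : ℕ) (r : ℝ) : Matrix (Fin K) (Fin (Fintype.card (StateIdx K))) ℝ :=
  Matrix.of fun k j => Sum.elim (fun _ => 0)
    (Sum.elim (fun k' => if k = k' then r else 0) fun _ => 0) (stateEquiv K j)

/-- Attention in which a token gives weight `r` to its own copies and `1` to all other tokens,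
followed by a gated and clipped read-out. -/
def robbinsLayer (K : ℕ) (r c : ℝ) : EncoderLayer (Fintype.card (StateIdx K)) where
  heads := 1
  dk := K + 1
  dv := K
  width := Fintype.card (Fin K ⊕ Fin K)
  WQ _ := queryWeights K r
  WK _ := keyWeights K
  WV _ := valueWeights K
  WO _ := outputWeights K r
  -- The summand `(K + 1) * r` is present exactly when the token matches the slot, and the bias
  -- removes it again. Without a match the preactivation is nonpositive, since a frequency is at
  -- most `r` and its factor at most `K + 1`.
  W₁ := Matrix.of fun j p => Sum.elim
    (fun a => if a = (Sum.elim id id (neuronEquiv K p)).castSucc then (K + 1) * r else 0)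
    (Sum.elim (fun k => if k = Sum.elim id id (neuronEquiv K p) then (k : ℝ) + 1 else 0)
      fun _ => 0) (stateEquiv K j)
  b₁ p := Sum.elim (fun _ => -((K + 1) * r)) (fun _ => -((K + 1) * r) - c) (neuronEquiv K p)
  W₂ := Matrix.of fun p j => Sum.elim (fun _ => 0) (Sum.elim (fun _ => 0)
    fun _ => Sum.elim (fun _ => 1) (fun _ => -1) (neuronEquiv K p)) (stateEquiv K j)
  b₂ _ := 0

/-- A transformer which, at a token `x < K`, outputs the estimate
`(x + 1) N(x + 1) / (N(x) + r⁻¹ (n - N(x)))` clipped at `c`; see `robbinsTransformer_eval`. -/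
def robbinsTransformer (K : ℕ) (r c : ℝ) : Transformer where
  vocab := K + 1
  dmodel := Fintype.card (StateIdx K)
  embed := Matrix.of fun t j => mkState t (fun _ => 0) 0 (stateEquiv K j)
  layers := [robbinsLayer K r c]
  decode j := Sum.elim (fun _ => 0) (Sum.elim (fun _ => 0) fun _ => 1) (stateEquiv K j)
  bias := 0

lemma numParams_robbinsTransformer (K : ℕ) (r c : ℝ) :
    (robbinsTransformer K r c).numParams ≤ 50 * (K + 1) ^ 2 := by
  simp only [Transformer.numParams, robbinsTransformer, robbinsLayer, EncoderLayer.numParams,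
    List.map_cons, List.map_nil, List.sum_cons, List.sum_nil, Fintype.card_sum, Fintype.card_fin,
    Fintype.card_unit]
  nlinarith

lemma embedInput_robbinsTransformer (K : ℕ) (r c : ℝ) {n : ℕ} (x : Fin n → ℕ) :
    (robbinsTransformer K r c).embedInput x =
      Matrix.of fun i j => mkState (x i) (fun _ => 0) 0 (stateEquiv K j) := by
  ext i j
  simp only [Transformer.embedInput, Matrix.of_apply]
  split_ifs with h
  · rfl
  -- A token outside the vocabulary equals no index of the one-hot block, so its formal one-hot
  -- state is already the zero vector.
  · refine Eq.symm (?_ : mkState (x i) (fun _ => 0) 0 (stateEquiv K j) = 0)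
    rcases stateEquiv K j with a | k | u
    · have : x i ≠ a := fun h' => h (h' ▸ a.2)
      simp [mkState, this]
    · simp [mkState]
    · simp [mkState]

/-- The attention score of a query token `s` at a key token `t`. -/
def score (K : ℕ) (r : ℝ) (s t : ℕ) : ℝ := if s = t ∧ s < K + 1 then Real.log r else 0

/-- The attention-weighted frequency of the token `k + 1` seen from position `i`. -/
def freq (K : ℕ) (r : ℝ) {n : ℕ} (x : Fin n → ℕ) (i : Fin n) (k : Fin K) : ℝ :=
  (∑ l, Real.exp (score K r (x i) (x l)) / (∑ l, Real.exp (score K r (x i) (x l))) *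
    if x l = k + 1 then 1 else 0) * r

lemma sum_mkState_mul {K : ℕ} (t : ℕ) (u : Fin K → ℝ) (o : ℝ) (F : StateIdx K → ℝ) :
    ∑ j, mkState t u o (stateEquiv K j) * F (stateEquiv K j) =
      (∑ a : Fin (K + 1), if t = a then F (Sum.inl a) else 0) +
        (∑ k, u k * F (Sum.inr (Sum.inl k)) + o * F (Sum.inr (Sum.inr ()))) := by
  rw [Equiv.sum_comp (stateEquiv K) fun s => mkState t u o s * F s]
  simp [Fintype.sum_sum_type, mkState]

lemma sum_ite_eq_val {K : ℕ} (t : ℕ) (k : Fin K) (b : ℝ) :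
    (∑ a : Fin K, if t = a then if a = k then b else 0 else 0) = if t = k then b else 0 := by
  rw [Finset.sum_eq_single k]
  · simp
  · intro a _ ha
    simp [ha]
  · simp

lemma attend_robbinsLayer (K : ℕ) (r c : ℝ) {n : ℕ} (x : Fin n → ℕ) :
    (robbinsLayer K r c).attend
        (Matrix.of fun i j => mkState (x i) (fun _ => 0) 0 (stateEquiv K j)) =
      Matrix.of fun i j => mkState (x i) (freq K r x i) 0 (stateEquiv K j) := by
  set H : Matrix (Fin n) (Fin (Fintype.card (StateIdx K))) ℝ :=
    Matrix.of fun i j => mkState (x i) (fun _ => 0) 0 (stateEquiv K j) with hH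
  have hQ : H * queryWeights K r = Matrix.of fun i (k : Fin (K + 1)) =>
      if x i = k then Real.log r * Real.sqrt ((K + 1 : ℕ) : ℝ) else 0 := by
    ext i k
    refine (sum_mkState_mul (x i) (fun _ => 0) 0 _).trans ?_
    simpa using! sum_ite_eq_val (x i) k (Real.log r * Real.sqrt ((K + 1 : ℕ) : ℝ))
  have hK : H * keyWeights K = Matrix.of fun i (k : Fin (K + 1)) =>
      if x i = k then 1 else 0 := by
    ext i k
    refine (sum_mkState_mul (x i) (fun _ => 0) 0 _).trans ?_
    simpa using! sum_ite_eq_val (x i) k 1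
  have hV : H * valueWeights K = Matrix.of fun i (k : Fin K) =>
      if x i = k + 1 then 1 else 0 := by
    ext i k
    refine (sum_mkState_mul (x i) (fun _ => 0) 0 _).trans ?_
    simpa using! sum_ite_eq_val (x i) k.succ 1
  have hS : (1 / Real.sqrt ((K + 1 : ℕ) : ℝ)) • ((H * queryWeights K r) *
      (H * keyWeights K)ᵀ) = Matrix.of fun i l => score K r (x i) (x l) := by
    rw [hQ, hK]
    ext i l
    have hpos : Real.sqrt ((K + 1 : ℕ) : ℝ) ≠ 0 := by positivity
    have : (∑ k : Fin (K + 1), (if x i = k then Real.log r * Real.sqrt ((K + 1 : ℕ) : ℝ) else 0) *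
        (if x l = k then (1 : ℝ) else 0)) =
        if x i = x l ∧ x i < K + 1 then Real.log r * Real.sqrt ((K + 1 : ℕ) : ℝ) else 0 := by
      by_cases h : x i < K + 1
      · rw [Finset.sum_eq_single ⟨x i, h⟩]
        · simp [h, eq_comm]
        · intro b _ hb
          have : x i ≠ b := fun h' => hb (by ext; exact h'.symm)
          simp [this]
        · simp
      · refine (Finset.sum_eq_zero fun k _ => ?_).trans (by simp [h])
        have : x i ≠ k := fun h' => h (h' ▸ k.2)
        simp [this]
    change (1 / Real.sqrt ((K + 1 : ℕ) : ℝ)) * (∑ k : Fin (K + 1), _) = _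
    simp only [Matrix.of_apply, Matrix.transpose_apply]
    rw [this, score]
    split_ifs
    · field_simp
    · simp
  have hA : attention (H * queryWeights K r) (H * keyWeights K)
      (H * valueWeights K) * outputWeights K r =
      Matrix.of fun i j => Sum.elim (fun _ => 0) (Sum.elim (freq K r x i) fun _ => 0)
        (stateEquiv K j) := by
    have h1 : attention (H * queryWeights K r) (H * keyWeights K)
        (H * valueWeights K) =
        softmax (Matrix.of fun i l => score K r (x i) (x l)) *
          (H * valueWeights K) := by
      rw [attention]
      congr 2
    rw [h1, hV]
    ext i j
    rw [Matrix.mul_apply]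
    simp only [outputWeights, Matrix.of_apply]
    rcases stateEquiv K j with a | k | u
    · simp
    · simp [freq, softmax, Matrix.mul_apply]
    · simp
  have hsum : (robbinsLayer K r c).attend H = H + (attention (H * queryWeights K r)
      (H * keyWeights K) (H * valueWeights K) *
        outputWeights K r) := by
    rw [EncoderLayer.attend]
    congr 1
    exact Fin.sum_univ_one _
  rw [hsum, hA]
  ext i j
  simp only [hH, Matrix.add_apply, Matrix.of_apply, mkState]
  rcases stateEquiv K j with a | k | u <;> simp

/-! ### Values of the attention and of the gated read-out -/

lemma freq_nonneg {K : ℕ} {r : ℝ} (hr : 0 ≤ r) {n : ℕ} (x : Fin n → ℕ) (i : Fin n) (k : Fin K) :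
    0 ≤ freq K r x i k := by
  unfold freq
  positivity

/-- Softmax weights sum to `1`. The bound is what guarantees that the gate closes all slots not
belonging to the token. -/
lemma freq_le {K : ℕ} {r : ℝ} (hr : 0 ≤ r) {n : ℕ} (x : Fin n → ℕ) (i : Fin n) (k : Fin K) :
    freq K r x i k ≤ r := by
  refine mul_le_of_le_one_left hr ?_
  have hZ : 0 < ∑ l, Real.exp (score K r (x i) (x l)) :=
    Finset.sum_pos (fun l _ => Real.exp_pos _) ⟨i, Finset.mem_univ _⟩
  calc _ ≤ ∑ l, Real.exp (score K r (x i) (x l)) / (∑ l, Real.exp (score K r (x i) (x l))) := by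
        refine Finset.sum_le_sum fun l _ => mul_le_of_le_one_right (by positivity) ?_
        split_ifs <;> simp
    _ = 1 := by rw [← Finset.sum_div, div_self hZ.ne']

/-- Copies of `k` carry exponential weight `r` and every other token weight `1`; in particular a
token `k + 1` has weight `1`, and the factor `r` comes from the output projection. -/
lemma freq_self {K : ℕ} {r : ℝ} (hr : 0 < r) {n : ℕ} (x : Fin n → ℕ) (i : Fin n) (k : Fin K)
    (hk : x i = k) :
    freq K r x i k = r * count x (k + 1) / (r * count x k + (n - count x k)) := by
  have hexp : ∀ l, Real.exp (score K r (x i) (x l)) = if x l = k then r else 1 := by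
    intro l
    have : (k : ℕ) < K + 1 := by omega
    simp only [score, hk, this, and_true, eq_comm (a := (k : ℕ))]
    split_ifs
    · exact Real.exp_log hr
    · exact Real.exp_zero
  have hZ : ∑ l, Real.exp (score K r (x i) (x l)) = r * count x k + (n - count x k) := by
    have : (n : ℝ) = ∑ l : Fin n, 1 := by simp
    rw [count, this, Finset.mul_sum, ← Finset.sum_sub_distrib, ← Finset.sum_add_distrib]
    refine Finset.sum_congr rfl fun l _ => ?_
    rw [hexp]
    split_ifs <;> simp
  rw [freq, hZ, Finset.sum_mul, count.eq_1 x (k + 1), Finset.mul_sum, Finset.sum_div]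
  refine Finset.sum_congr rfl fun l _ => ?_
  rw [hexp]
  split_ifs with h1 h2
  · omega
  · ring
  · ring
  · ring

lemma robbinsTransformer_eval (K : ℕ) {r c : ℝ} (hr : 0 < r) (hc : 0 ≤ c) {n : ℕ}
    (x : Fin n → ℕ) (i : Fin n) :
    (robbinsTransformer K r c).eval x i = if x i < K then
      min ((x i + 1) * (r * count x (x i + 1) / (r * count x (x i) + (n - count x (x i))))) c
      else 0 := by
  have henc : (robbinsTransformer K r c).encode x = (robbinsLayer K r c).feedForward
      (Matrix.of fun i j => mkState (x i) (freq K r x i) 0 (stateEquiv K j)) := by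
    rw [← attend_robbinsLayer, ← embedInput_robbinsTransformer K r c]
    rfl
  set u := freq K r x i with hu
  set z : Fin K → ℝ := fun k =>
    (if x i = k then (K + 1) * r else 0) + u k * (k + 1) - (K + 1) * r with hz
  have hpre : ∀ p, (∑ l, mkState (x i) u 0 (stateEquiv K l) * (robbinsLayer K r c).W₁ l p) +
      (robbinsLayer K r c).b₁ p = Sum.elim z (fun k => z k - c) (neuronEquiv K p) := by
    intro p
    have h1 := sum_mkState_mul (x i) u 0 (Sum.elim
      (fun a => if a = (Sum.elim id id (neuronEquiv K p)).castSucc then (K + 1) * r else 0)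
      (Sum.elim (fun k => if k = Sum.elim id id (neuronEquiv K p) then (k : ℝ) + 1 else 0)
      fun _ => 0))
    refine (congrArg (· + (robbinsLayer K r c).b₁ p) h1).trans ?_
    have h2 : ∀ k₀ : Fin K, ∑ k, u k * (if k = k₀ then (k : ℝ) + 1 else 0) = u k₀ * (k₀ + 1) := by
      simp
    have h3 := fun k₀ : Fin K => sum_ite_eq_val (x i) k₀.castSucc ((K + 1) * r)
    simp only [Sum.elim_inl, Sum.elim_inr, robbinsLayer]
    rw [h2, h3]
    rcases neuronEquiv K p with k | k <;> simp [hz] <;> ring_nf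
  have hout : (robbinsTransformer K r c).eval x i =
      ∑ k, (max (z k) 0 - max (z k - c) 0) := by
    have h2 : (robbinsTransformer K r c).eval x i = (robbinsLayer K r c).feedForward
        (Matrix.of fun i j => mkState (x i) (freq K r x i) 0 (stateEquiv K j)) i
          ((stateEquiv K).symm (Sum.inr (Sum.inr ()))) := by
      rw [Transformer.eval, henc]
      refine (congrArg (· + (0 : ℝ)) (Finset.sum_eq_single
        ((stateEquiv K).symm (Sum.inr (Sum.inr ()))) ?_ ?_)).trans ?_
      · intro j _ hj
        simp only [robbinsTransformer]
        rcases hs : stateEquiv K j with a | k | w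
        · simp
        · simp
        · exact absurd ((Equiv.eq_symm_apply _).2 hs) hj
      · exact fun h => absurd (Finset.mem_univ _) h
      · simp [robbinsTransformer]
    rw [h2]
    simp only [EncoderLayer.feedForward, Matrix.of_apply]
    rw [← hu]
    simp only [hpre]
    simp only [robbinsLayer, Matrix.of_apply, Equiv.apply_symm_apply, mkState, Sum.elim_inr,
      zero_add, add_zero]
    refine (Equiv.sum_comp (neuronEquiv K) fun s => max (Sum.elim z (fun k => z k - c) s) 0 *
      Sum.elim (fun _ => 1) (fun _ => -1) s).trans ?_
    simp [Fintype.sum_sum_type, ← sub_eq_add_neg]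
  rw [hout]
  have hu0 : ∀ k, 0 ≤ u k := fun k => freq_nonneg hr.le x i k
  have hule : ∀ k, u k * (k + 1) ≤ (K + 1) * r := by
    intro k
    have h1 : u k ≤ r := freq_le hr.le x i k
    have h2 : ((k : ℕ) : ℝ) + 1 ≤ K + 1 := by
      have : ((k : ℕ) : ℝ) ≤ K := by exact_mod_cast k.2.le
      linarith
    calc u k * (k + 1) ≤ r * (K + 1) := mul_le_mul h1 h2 (by positivity) hr.le
      _ = _ := by ring
  -- For `z ≥ 0` the two neurons of a slot give `max z 0 - max (z - c) 0 = min z c`; for `z ≤ 0`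
  -- both vanish.
  have hterm : ∀ k, max (z k) 0 - max (z k - c) 0 =
      if x i = k then min ((k + 1) * u k) c else 0 := by
    intro k
    simp only [hz]
    have h0 : 0 ≤ u k * (k + 1) := mul_nonneg (hu0 k) (by positivity)
    split_ifs with h
    · have e : (K + 1) * r + u k * (k + 1) - (K + 1) * r = u k * (k + 1) := by ring
      rw [e, max_eq_left h0, mul_comm (u k)]
      rcases le_total ((k + 1 : ℝ) * u k) c with h' | h'
      · rw [min_eq_left h', max_eq_right (by linarith)]; ring
      · rw [min_eq_right h', max_eq_left (by linarith)]; ring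
    · have := hule k
      rw [max_eq_right (by linarith), max_eq_right (by linarith)]; ring
  simp only [hterm]
  split_ifs with h
  · rw [Finset.sum_eq_single ⟨x i, h⟩]
    · simp only [if_true]
      rw [hu, freq_self hr x i ⟨x i, h⟩ rfl]
    · intro b _ hb
      have : x i ≠ b := fun h' => hb (by ext; exact h'.symm)
      simp [this]
    · simp
  · refine Finset.sum_eq_zero fun k _ => ?_
    have : x i ≠ k := fun h' => h (h' ▸ k.2)
    simp [this]

end PoissonEB

end

noncomputable section

namespace PoissonEB

/-! ### The Poisson mixture model -/

section Model

variable {π : Measure ℝ} {c : ℝ}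

/-- The marginal probability of the observation `x`. -/
def marginal (π : Measure ℝ) (x : ℕ) : ℝ := (jointLaw π).real {z | z.2 = x}

lemma measurableSet_snd_eq (x : ℕ) : MeasurableSet {z : ℝ × ℕ | z.2 = x} :=
  measurable_snd (measurableSet_singleton x)

lemma marginal_nonneg (x : ℕ) : 0 ≤ marginal π x := measureReal_nonneg

lemma poissonObs_real_singleton (θ : ℝ) (x : ℕ) :
    (poissonObs θ).real {x} = Real.exp (-θ.toNNReal) * θ.toNNReal ^ x / (x.factorial : ℝ) :=
  poissonMeasure_real_singleton _ _

lemma ae_mem_Icc (hπ : π (Set.Icc 0 c)ᶜ = 0) : ∀ᵐ θ ∂π, θ ∈ Set.Icc 0 c :=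
  hπ

lemma ae_jointLaw_fst_mem_Icc (hπ : π (Set.Icc 0 c)ᶜ = 0) :
    ∀ᵐ z ∂jointLaw π, z.1 ∈ Set.Icc 0 c :=
  Measure.ae_compProd_of_ae_fst _ measurableSet_Icc hπ

lemma bayesEstimator_eq (x : ℕ) :
    bayesEstimator π x = (marginal π x)⁻¹ * ∫ z in {z | z.2 = x}, z.1 ∂jointLaw π := by
  rw [bayesEstimator, ProbabilityTheory.cond, integral_smul_measure, ENNReal.toReal_inv]
  rfl

variable [IsProbabilityMeasure π]

instance : IsProbabilityMeasure (jointLaw π) :=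
  inferInstanceAs (IsProbabilityMeasure (π ⊗ₘ poissonObs))

lemma integrable_fst_jointLaw (hπ : π (Set.Icc 0 c)ᶜ = 0) :
    Integrable (fun z : ℝ × ℕ => z.1) (jointLaw π) :=
  Integrable.of_mem_Icc 0 c measurable_fst.aemeasurable (ae_jointLaw_fst_mem_Icc hπ)

lemma setIntegral_snd_eq (g : ℝ → ℝ) (hg : Integrable (fun z : ℝ × ℕ => g z.1) (jointLaw π))
    (x : ℕ) :
    ∫ z in {z | z.2 = x}, g z.1 ∂jointLaw π = ∫ θ, (poissonObs θ).real {x} * g θ ∂π := by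
  have h1 : {z : ℝ × ℕ | z.2 = x} = Set.univ ×ˢ {x} := by ext; simp
  rw [h1, jointLaw, Measure.setIntegral_compProd MeasurableSet.univ (measurableSet_singleton x)
    hg.integrableOn, Measure.restrict_univ]
  refine integral_congr_ae (Eventually.of_forall fun θ => ?_)
  simp only [integral_singleton, smul_eq_mul]

lemma marginal_eq_integral (x : ℕ) : marginal π x = ∫ θ, (poissonObs θ).real {x} ∂π := by
  have := setIntegral_snd_eq (π := π) (fun _ => 1) (integrable_const _) x
  simpa [marginal] using this

/-- Robbins' identity: `θ Poi(θ)(x) = (x + 1) Poi(θ)(x + 1)`, integrated over the prior. -/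
lemma setIntegral_fst (hπ : π (Set.Icc 0 c)ᶜ = 0) (x : ℕ) :
    ∫ z in {z | z.2 = x}, z.1 ∂jointLaw π = (x + 1) * marginal π (x + 1) := by
  rw [setIntegral_snd_eq (fun θ => θ) (integrable_fst_jointLaw hπ), marginal_eq_integral,
    ← integral_const_mul]
  refine integral_congr_ae ?_
  filter_upwards [ae_mem_Icc hπ] with θ hθ
  simp only [poissonObs_real_singleton, Real.coe_toNNReal θ hθ.1, Nat.factorial_succ]
  have : (x.factorial : ℝ) ≠ 0 := by positivity
  have : (x + 1 : ℝ) ≠ 0 := by positivity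
  push_cast
  field_simp
  ring

/-- The product form remains valid at observations of probability zero, where both sides vanish. -/
lemma bayesEstimator_mul_marginal (x : ℕ) :
    bayesEstimator π x * marginal π x = ∫ z in {z | z.2 = x}, z.1 ∂jointLaw π := by
  by_cases h : marginal π x = 0
  · rw [h, mul_zero, Measure.restrict_eq_zero.2, integral_zero_measure]
    exact (measureReal_eq_zero_iff).1 h
  · rw [bayesEstimator_eq]
    field_simp

lemma bayesEstimator_mem_Icc (hc : 0 ≤ c) (hπ : π (Set.Icc 0 c)ᶜ = 0) (x : ℕ) :
    bayesEstimator π x ∈ Set.Icc 0 c := by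
  have h0 : 0 ≤ ∫ z in {z | z.2 = x}, z.1 ∂jointLaw π := by
    refine integral_nonneg_of_ae (ae_restrict_of_ae ?_)
    filter_upwards [ae_jointLaw_fst_mem_Icc hπ] with z hz using hz.1
  have h1 : ∫ z in {z | z.2 = x}, z.1 ∂jointLaw π ≤ c * marginal π x := by
    have : ∫ z in {z : ℝ × ℕ | z.2 = x}, c ∂jointLaw π = c * marginal π x := by
      simp [marginal, mul_comm]
    rw [← this]
    refine integral_mono_ae (integrable_fst_jointLaw hπ).integrableOn (integrable_const _)
      (ae_restrict_of_ae ?_)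
    filter_upwards [ae_jointLaw_fst_mem_Icc hπ] with z hz using hz.2
  rw [bayesEstimator_eq]
  refine ⟨mul_nonneg (inv_nonneg.2 (marginal_nonneg x)) h0, ?_⟩
  rw [inv_mul_eq_div]
  exact div_le_of_le_mul₀ (marginal_nonneg x) hc h1

/-- The posterior residual is orthogonal to every bounded function of the observation. -/
lemma integral_mul_residual (hc : 0 ≤ c) (hπ : π (Set.Icc 0 c)ᶜ = 0) {g : ℕ → ℝ} {C : ℝ}
    (hg : ∀ x, |g x| ≤ C) :
    ∫ z, g z.2 * (bayesEstimator π z.2 - z.1) ∂jointLaw π = 0 := by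
  have hb : Integrable (fun z : ℝ × ℕ => bayesEstimator π z.2 - z.1) (jointLaw π) :=
    (Integrable.of_mem_Icc 0 c (Measurable.comp (g := bayesEstimator π) .of_discrete
      measurable_snd).aemeasurable (Eventually.of_forall fun z =>
        bayesEstimator_mem_Icc hc hπ z.2)).sub (integrable_fst_jointLaw hπ)
  have hi : Integrable (fun z : ℝ × ℕ => g z.2 * (bayesEstimator π z.2 - z.1)) (jointLaw π) :=
    hb.bdd_mul (c := C) (Measurable.of_discrete.comp measurable_snd).aestronglyMeasurable
      (Eventually.of_forall fun z => hg z.2)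
  have hU : (⋃ x, {z : ℝ × ℕ | z.2 = x}) = Set.univ := by ext; simp
  rw [← setIntegral_univ, ← hU, integral_iUnion measurableSet_snd_eq ?_ hi.integrableOn]
  · have : ∀ x : ℕ, ∫ z in {z | z.2 = x}, g z.2 * (bayesEstimator π z.2 - z.1) ∂jointLaw π = 0 := by
      intro x
      have h1 : ∫ z in {z | z.2 = x}, g z.2 * (bayesEstimator π z.2 - z.1) ∂jointLaw π =
          ∫ z in {z | z.2 = x}, g x * (bayesEstimator π x - z.1) ∂jointLaw π := by
        refine setIntegral_congr_fun (measurableSet_snd_eq x) fun z hz => ?_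
        have hz' : z.2 = x := hz
        simp only [hz']
      rw [h1, integral_const_mul, integral_sub (integrable_const _)
        (integrable_fst_jointLaw hπ).integrableOn, ← bayesEstimator_mul_marginal]
      simp [marginal, mul_comm]
    simp [this]
  · intro x y hxy
    refine Set.disjoint_left.2 fun z hz hz' => hxy ?_
    exact (show z.2 = x from hz).symm.trans hz'

/-- Pythagoras: the cross term vanishes by `integral_mul_residual`, so excess risk is squared
distance to the posterior mean. -/
lemma integral_sq_sub_fst (hc : 0 ≤ c) (hπ : π (Set.Icc 0 c)ᶜ = 0) {t : ℕ → ℝ}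
    (ht : ∀ x, t x ∈ Set.Icc 0 c) :
    ∫ z, (t z.2 - z.1) ^ 2 ∂jointLaw π =
      mmse π + ∫ z, (t z.2 - bayesEstimator π z.2) ^ 2 ∂jointLaw π := by
  have hb := bayesEstimator_mem_Icc hc hπ
  have hbd : ∀ x, |t x - bayesEstimator π x| ≤ c := fun x => by
    have := ht x; have := hb x
    simp only [Set.mem_Icc] at *
    exact abs_le.2 ⟨by linarith, by linarith⟩
  have hmeas : ∀ h : ℕ → ℝ, Measurable fun z : ℝ × ℕ => h z.2 := fun h =>
    Measurable.of_discrete.comp measurable_snd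
  have h1 : Integrable (fun z : ℝ × ℕ => (bayesEstimator π z.2 - z.1) ^ 2) (jointLaw π) := by
    refine Integrable.of_mem_Icc 0 (c ^ 2)
      (((hmeas _).sub measurable_fst).pow_const 2).aemeasurable ?_
    filter_upwards [ae_jointLaw_fst_mem_Icc hπ] with z hz
    have := hb z.2
    simp only [Set.mem_Icc] at *
    exact ⟨sq_nonneg _, sq_le_sq' (by linarith) (by linarith)⟩
  have h2 : Integrable (fun z : ℝ × ℕ => (t z.2 - bayesEstimator π z.2) ^ 2) (jointLaw π) := by
    refine Integrable.of_mem_Icc 0 (c ^ 2)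
      (((hmeas _).sub (hmeas _)).pow_const 2).aemeasurable (Eventually.of_forall fun z => ?_)
    exact ⟨sq_nonneg _, sq_le_sq.2 ((hbd _).trans (le_abs_self c))⟩
  have h3 : Integrable (fun z : ℝ × ℕ =>
      (2 * (t z.2 - bayesEstimator π z.2)) * (bayesEstimator π z.2 - z.1)) (jointLaw π) := by
    refine Integrable.bdd_mul (c := 2 * c) ?_
      ((hmeas fun x => 2 * (t x - bayesEstimator π x)).aestronglyMeasurable)
      (Eventually.of_forall fun z => ?_)
    · exact (Integrable.of_mem_Icc 0 c (hmeas _).aemeasurable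
        (Eventually.of_forall fun z => hb z.2)).sub (integrable_fst_jointLaw hπ)
    · rw [Real.norm_eq_abs, abs_mul, abs_two]
      linarith [hbd z.2]
  have h4 : ∫ z, (2 * (t z.2 - bayesEstimator π z.2)) * (bayesEstimator π z.2 - z.1) ∂jointLaw π
      = 0 := by
    refine integral_mul_residual hc hπ (g := fun x => 2 * (t x - bayesEstimator π x))
      (C := 2 * c) fun x => ?_
    rw [abs_mul, abs_two]
    linarith [hbd x]
  have h5 : (fun z : ℝ × ℕ => (t z.2 - z.1) ^ 2) = fun z =>
      ((bayesEstimator π z.2 - z.1) ^ 2 + (t z.2 - bayesEstimator π z.2) ^ 2) +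
        (2 * (t z.2 - bayesEstimator π z.2)) * (bayesEstimator π z.2 - z.1) := by
    funext z; ring
  rw [h5]
  refine (integral_add (h1.add h2) h3).trans ?_
  rw [h4, add_zero]
  exact integral_add h1 h2

/-! ### Poisson tails and truncation of the observation -/

lemma poissonMeasure_real_Ici_le (a : ℝ≥0) (K : ℕ) :
    (poissonMeasure a).real {y | K ≤ y} ≤ Real.exp (-K) * Real.exp (Real.exp 1 * a) := by
  have h1 : HasSum (fun n : ℕ => (Real.exp (-a) * a ^ n / (n.factorial : ℝ)) •
      Set.indicator {y | K ≤ y} (fun _ => (1 : ℝ)) n) ((poissonMeasure a).real {y | K ≤ y}) := by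
    have := hasSum_integral_poissonMeasure (r := a)
      (f := Set.indicator {y | K ≤ y} (fun _ => (1 : ℝ)))
      ((integrable_const 1).indicator .of_discrete)
    rwa [integral_indicator_const _ .of_discrete, smul_eq_mul, mul_one] at this
  have h2 : HasSum (fun n : ℕ => Real.exp (-K) * ((Real.exp 1 * a) ^ n / (n.factorial : ℝ)))
      (Real.exp (-K) * Real.exp (Real.exp 1 * a)) := by
    have := (NormedSpace.expSeries_div_hasSum_exp (Real.exp 1 * a : ℝ)).mul_left (Real.exp (-K))
    rwa [← Real.exp_eq_exp_ℝ] at this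
  refine hasSum_le (fun n => ?_) h1 h2
  by_cases hn : K ≤ n
  -- Chernoff bound term by term: the indicator of `K ≤ n` is at most `e^{n - K}`, and the factor
  -- `e^{-a}` is discarded.
  · have e1 : Real.exp (-a) ≤ 1 := Real.exp_le_one_iff.2 (by simp)
    have e2 : 1 ≤ Real.exp (-K) * Real.exp 1 ^ n := by
      rw [← Real.exp_nat_mul, ← Real.exp_add]
      refine Real.one_le_exp ?_
      have : (K : ℝ) ≤ n := by exact_mod_cast hn
      linarith
    rw [Set.indicator_of_mem (by exact hn), smul_eq_mul, mul_one, mul_pow, ← mul_div_assoc,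
      ← mul_assoc]
    have : Real.exp (-a) ≤ Real.exp (-K) * Real.exp 1 ^ n := e1.trans e2
    gcongr
  · rw [Set.indicator_of_notMem (by exact hn), smul_zero]
    positivity

lemma jointLaw_real_tail_le (hπ : π (Set.Icc 0 c)ᶜ = 0) (K : ℕ) :
    (jointLaw π).real {z | K ≤ z.2} ≤ Real.exp (-K) * Real.exp (Real.exp 1 * c) := by
  refine ENNReal.toReal_le_of_le_ofReal (by positivity) ?_
  have hm : MeasurableSet {z : ℝ × ℕ | K ≤ z.2} :=
    measurable_snd (MeasurableSet.of_discrete (s := {y | K ≤ y}))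
  rw [jointLaw, Measure.compProd_apply hm]
  calc _ ≤ ∫⁻ _, ENNReal.ofReal (Real.exp (-K) * Real.exp (Real.exp 1 * c)) ∂π := by
        refine lintegral_mono_ae ?_
        filter_upwards [ae_mem_Icc hπ] with θ hθ
        refine (ENNReal.le_ofReal_iff_toReal_le (measure_ne_top _ _) (by positivity)).2 ?_
        refine (poissonMeasure_real_Ici_le θ.toNNReal K).trans ?_
        rw [Real.coe_toNNReal θ hθ.1]
        have := hθ.2
        gcongr
    _ = _ := by simp

lemma integral_sq_sub_bayesEstimator_le (hc : 0 ≤ c) (hπ : π (Set.Icc 0 c)ᶜ = 0) {t : ℕ → ℝ}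
    (ht : ∀ x, t x ∈ Set.Icc 0 c) (K : ℕ) :
    ∫ z, (t z.2 - bayesEstimator π z.2) ^ 2 ∂jointLaw π ≤
      ∑ x ∈ Finset.range K, marginal π x * (t x - bayesEstimator π x) ^ 2 +
        c ^ 2 * (Real.exp (-K) * Real.exp (Real.exp 1 * c)) := by
  have hb := bayesEstimator_mem_Icc hc hπ
  have hsq : ∀ x, (t x - bayesEstimator π x) ^ 2 ∈ Set.Icc 0 (c ^ 2) := fun x => by
    have := ht x; have := hb x
    simp only [Set.mem_Icc] at *
    exact ⟨sq_nonneg _, sq_le_sq' (by linarith) (by linarith)⟩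
  have hm : MeasurableSet {z : ℝ × ℕ | K ≤ z.2} :=
    measurable_snd (MeasurableSet.of_discrete (s := {y | K ≤ y}))
  have hi1 : ∀ x ∈ Finset.range K, Integrable (Set.indicator {z : ℝ × ℕ | z.2 = x}
      fun _ => (t x - bayesEstimator π x) ^ 2) (jointLaw π) := fun x _ =>
    (integrable_const _).indicator (measurableSet_snd_eq x)
  have hi2 : Integrable (Set.indicator {z : ℝ × ℕ | K ≤ z.2} fun _ => c ^ 2) (jointLaw π) :=
    (integrable_const _).indicator hm
  calc _ ≤ ∫ z, (∑ x ∈ Finset.range K, Set.indicator {z : ℝ × ℕ | z.2 = x}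
          (fun _ => (t x - bayesEstimator π x) ^ 2) z +
          Set.indicator {z : ℝ × ℕ | K ≤ z.2} (fun _ => c ^ 2) z) ∂jointLaw π := by
        refine integral_mono ?_ ((integrable_finsetSum _ hi1).add hi2) fun z => ?_
        · exact Integrable.of_mem_Icc 0 (c ^ 2) (Measurable.comp
            (g := fun x => (t x - bayesEstimator π x) ^ 2) .of_discrete
            measurable_snd).aemeasurable (Eventually.of_forall fun z => hsq z.2)
        · have hnn : ∀ x ∈ Finset.range K, 0 ≤ Set.indicator {z : ℝ × ℕ | z.2 = x}
              (fun _ => (t x - bayesEstimator π x) ^ 2) z := fun x _ =>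
            Set.indicator_nonneg (fun _ _ => sq_nonneg _) _
          by_cases hz : z.2 < K
          · have h1 := Finset.single_le_sum hnn (Finset.mem_range.2 hz)
            have h2 : Set.indicator {z : ℝ × ℕ | K ≤ z.2} (fun _ => c ^ 2) z = 0 :=
              Set.indicator_of_notMem (by simpa using hz) _
            simp only at h1 ⊢
            rw [h2, add_zero]
            refine le_trans (le_of_eq ?_) h1
            rw [Set.indicator_of_mem (by rfl)]
          · have h2 : Set.indicator {z : ℝ × ℕ | K ≤ z.2} (fun _ => c ^ 2) z = c ^ 2 :=
              Set.indicator_of_mem (by simpa using hz) _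
            simp only
            rw [h2]
            linarith [(hsq z.2).2, Finset.sum_nonneg hnn]
    _ = ∑ x ∈ Finset.range K, marginal π x * (t x - bayesEstimator π x) ^ 2 +
        (jointLaw π).real {z | K ≤ z.2} * c ^ 2 := by
        rw [integral_add (integrable_finsetSum _ hi1) hi2, integral_finsetSum _ hi1,
          integral_indicator_const _ hm]
        congr 1
        refine Finset.sum_congr rfl fun x _ => ?_
        rw [integral_indicator_const _ (measurableSet_snd_eq x)]
        rfl
    _ ≤ _ := by
        rw [mul_comm (c ^ 2)]
        have := jointLaw_real_tail_le hπ K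
        gcongr

end Model

end PoissonEB

end

noncomputable section

namespace PoissonEB

/-! ### The risk of the regularized Robbins estimator -/

section Risk

/-- Deterministic error bound, with `M` other observations, `N` of them equal to `x`, and `Q` equal
to `x + 1`. The last term pays for an atypically small `N`, the first for the noise in Robbins'
ratio, the middle one for the regularization. -/
lemma sq_error_robbins_le {y r Q N M c b f : ℝ} (hy : 0 ≤ y) (hr : 1 ≤ r) (hQ : 0 ≤ Q)
    (hN : 0 ≤ N) (hNM : N ≤ M) (hM : 0 < M) (hb : b ∈ Set.Icc 0 c) (hf : 0 < f) :
    (min (y * (r * Q / (r * (N + 1) + (M - N)))) c - b) ^ 2 ≤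
      8 / (M * f) ^ 2 * (y * Q - b * N) ^ 2 + 4 * c ^ 2 * (1 + M / r) / (M * f) +
        4 * c ^ 2 / (M * f) ^ 2 * (N - M * f) ^ 2 := by
  obtain ⟨hb0, hbc⟩ := hb
  have hr0 : 0 < r := by linarith
  have hMf : 0 < M * f := mul_pos hM hf
  -- After division by `r` the denominator is `N + g`: the `1` is the position's own token, the rest
  -- is attention leaking to other tokens.
  set g := 1 + (M - N) / r with hg
  have hg1 : 1 ≤ g := by
    have : 0 ≤ (M - N) / r := div_nonneg (by linarith) hr0.le
    linarith
  have hgM : g ≤ 1 + M / r := by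
    have : (M - N) / r ≤ M / r := by gcongr; linarith
    linarith
  have hD : 0 < N + g := by linarith
  have hT : y * (r * Q / (r * (N + 1) + (M - N))) = y * Q / (N + g) := by
    have : r * (N + 1) + (M - N) = r * (N + g) := by rw [hg]; field_simp; ring
    rw [this, mul_div_mul_left _ _ hr0.ne', mul_div_assoc]
  rw [hT]
  have hT0 : 0 ≤ y * Q / (N + g) := by positivity
  have h1 : 0 ≤ 8 / (M * f) ^ 2 * (y * Q - b * N) ^ 2 := by positivity
  have h2 : 0 ≤ 4 * c ^ 2 * (1 + M / r) / (M * f) := by positivity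
  have h3 : 0 ≤ 4 * c ^ 2 / (M * f) ^ 2 * (N - M * f) ^ 2 := by positivity
  -- If `N` is below half its mean, clipping bounds the error by `c²` and `(N - M f)² ≥ (M f / 2)²`.
  -- Otherwise the denominator is at least `M f / 2`.
  by_cases hcase : N < M * f / 2
  · have e1 : (min (y * Q / (N + g)) c - b) ^ 2 ≤ c ^ 2 := by
      have h4 : 0 ≤ min (y * Q / (N + g)) c := le_min hT0 (hb0.trans hbc)
      have h5 : min (y * Q / (N + g)) c ≤ c := min_le_right _ _
      exact sq_le_sq' (by linarith) (by linarith)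
    have e2 : c ^ 2 ≤ 4 * c ^ 2 / (M * f) ^ 2 * (N - M * f) ^ 2 := by
      have : (M * f / 2) ^ 2 ≤ (N - M * f) ^ 2 := by
        rw [← sq_abs (N - M * f), abs_of_neg (by linarith)]
        gcongr
        linarith
      calc c ^ 2 = 4 * c ^ 2 / (M * f) ^ 2 * (M * f / 2) ^ 2 := by field_simp; norm_num
        _ ≤ _ := by gcongr
    linarith
  · push Not at hcase
    have hDf : M * f / 2 ≤ N + g := by linarith
    have e1 : (min (y * Q / (N + g)) c - b) ^ 2 ≤ (y * Q / (N + g) - b) ^ 2 := by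
      rcases le_total (y * Q / (N + g)) c with h | h
      · rw [min_eq_left h]
      · rw [min_eq_right h]
        exact pow_le_pow_left₀ (by linarith) (by linarith) 2
    have e2 : y * Q / (N + g) - b = (y * Q - b * N) / (N + g) - b * (g / (N + g)) := by
      field_simp; ring
    have e3 : ((y * Q - b * N) / (N + g) - b * (g / (N + g))) ^ 2 ≤
        2 * ((y * Q - b * N) / (N + g)) ^ 2 + 2 * (b * (g / (N + g))) ^ 2 := by
      nlinarith [sq_nonneg ((y * Q - b * N) / (N + g) + b * (g / (N + g)))]
    have e4 : ((y * Q - b * N) / (N + g)) ^ 2 ≤ (y * Q - b * N) ^ 2 / (M * f / 2) ^ 2 := by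
      rw [div_pow]
      gcongr
    -- Using `t² ≤ t` on `[0, 1]` leaves only one factor `1 / f`, which the weight `f` cancels
    -- later.
    have e5 : (g / (N + g)) ^ 2 ≤ (1 + M / r) / (M * f / 2) := by
      have h6 : g / (N + g) ≤ 1 := (div_le_one hD).2 (by linarith)
      have h7 : 0 ≤ g / (N + g) := by positivity
      calc (g / (N + g)) ^ 2 ≤ g / (N + g) := by nlinarith
        _ ≤ _ := by gcongr
    have e6 : (b * (g / (N + g))) ^ 2 ≤ c ^ 2 * ((1 + M / r) / (M * f / 2)) := by
      rw [mul_pow]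
      gcongr
    have e7 : 2 * ((y * Q - b * N) ^ 2 / (M * f / 2) ^ 2) =
        8 / (M * f) ^ 2 * (y * Q - b * N) ^ 2 := by field_simp; ring
    have e8 : 2 * (c ^ 2 * ((1 + M / r) / (M * f / 2))) =
        4 * c ^ 2 * (1 + M / r) / (M * f) := by field_simp; ring
    rw [e2] at e1
    linarith

variable {π : Measure ℝ} {c : ℝ}

/-! ### Second moments of the counts -/

lemma integral_ite_snd (x : ℕ) (a : ℝ) :
    ∫ z, (if z.2 = x then a else 0) ∂jointLaw π = marginal π x * a := by
  have := integral_indicator_const (μ := jointLaw π) a (measurableSet_snd_eq x)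
  rw [smul_eq_mul] at this
  rw [marginal, ← this]
  refine integral_congr_ae (Eventually.of_forall fun z => ?_)
  simp [Set.indicator_apply]

variable [IsProbabilityMeasure π]

instance (n : ℕ) : IsProbabilityMeasure (sampleLaw π n) :=
  inferInstanceAs (IsProbabilityMeasure (Measure.pi fun _ : Fin n => jointLaw π))

/-- The observed sequence `(X₁, …, Xₙ)`. -/
def obs {n : ℕ} (ω : Fin n → ℝ × ℕ) : Fin n → ℕ := fun j => (ω j).2

lemma measurable_obs {n : ℕ} : Measurable (obs (n := n)) :=
  measurable_pi_lambda _ fun j => measurable_snd.comp (measurable_pi_apply j)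

lemma memLp_comp_snd {g : ℕ → ℝ} {C : ℝ} (hg : ∀ x, |g x| ≤ C) :
    MemLp (fun z : ℝ × ℕ => g z.2) 2 (jointLaw π) :=
  MemLp.of_bound (Measurable.comp (g := g) .of_discrete measurable_snd).aestronglyMeasurable C
    (Eventually.of_forall fun z => hg z.2)

lemma integral_sq_sum {g : ℕ → ℝ} {C : ℝ} (hg : ∀ x, |g x| ≤ C)
    (h0 : ∫ z, g z.2 ∂jointLaw π = 0) (n : ℕ) :
    ∫ ω, (∑ j, g (obs ω j)) ^ 2 ∂sampleLaw π n = n * ∫ z, g z.2 ^ 2 ∂jointLaw π := by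
  have hL := memLp_comp_snd (π := π) hg
  have hm : ∀ j : Fin n, Measurable fun ω : Fin n → ℝ × ℕ => g (obs ω j) := fun j =>
    Measurable.comp (g := g) .of_discrete ((measurable_pi_apply j).comp measurable_obs)
  have h1 := variance_sum_pi (μ := fun _ : Fin n => jointLaw π)
    (X := fun _ z => g z.2) fun _ => hL
  rw [variance_of_integral_eq_zero, Finset.sum_const, Finset.card_univ, Fintype.card_fin,
    variance_of_integral_eq_zero hL.aemeasurable h0, nsmul_eq_mul] at h1
  · rw [← h1]
    simp [obs, sampleLaw]
  · have : (∑ j, fun ω : Fin n → ℝ × ℕ => g (ω j).2) = fun ω => ∑ j, g (obs ω j) := by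
      ext; simp [obs]
    rw [this]
    exact (Finset.measurable_sum _ fun j _ => hm j).aemeasurable
  · simp only [Finset.sum_apply]
    rw [integral_finsetSum]
    · refine Finset.sum_eq_zero fun j _ => ?_
      rw [← h0]
      exact integral_comp_eval (μ := fun _ : Fin n => jointLaw π) (f := fun z => g z.2)
        hL.aestronglyMeasurable
    · exact fun j _ => integrable_comp_eval (μ := fun _ : Fin n => jointLaw π)
        (f := fun z => g z.2) (hL.integrable one_le_two)

lemma integrable_ite_snd (x : ℕ) (a : ℝ) :
    Integrable (fun z : ℝ × ℕ => if z.2 = x then a else 0) (jointLaw π) :=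
  ((integrable_const a).indicator (measurableSet_snd_eq x)).congr
    (Eventually.of_forall fun z => by simp [Set.indicator_apply])

lemma integral_sq_count_sub_le (x n : ℕ) :
    ∫ ω, (count (obs ω) x - n * marginal π x) ^ 2 ∂sampleLaw π n ≤ n * marginal π x := by
  set f := marginal π x with hf
  set g : ℕ → ℝ := fun k => (if k = x then 1 else 0) - f with hg
  have hb : ∀ k, |g k| ≤ 1 + |f| := fun k => by
    refine (abs_sub _ _).trans ?_
    gcongr
    split_ifs <;> simp
  have h0 : ∫ z, g z.2 ∂jointLaw π = 0 := by
    simp only [hg]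
    rw [integral_sub (integrable_ite_snd x 1) (integrable_const _), integral_ite_snd]
    simp [hf]
  have h2 : ∫ z, g z.2 ^ 2 ∂jointLaw π = f * (1 - 2 * f) + f ^ 2 := by
    have : ∀ z : ℝ × ℕ, g z.2 ^ 2 = (if z.2 = x then 1 - 2 * f else 0) + f ^ 2 := fun z => by
      simp only [hg]
      split_ifs <;> ring
    simp only [this]
    rw [integral_add (integrable_ite_snd x _) (integrable_const _), integral_ite_snd]
    simp [hf]
  have h3 := integral_sq_sum hb h0 n
  have h4 : ∀ ω : Fin n → ℝ × ℕ, ∑ j, g (obs ω j) = count (obs ω) x - n * f := fun ω => by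
    simp [hg, count]
  simp only [h4, h2] at h3
  rw [h3]
  gcongr
  nlinarith [sq_nonneg f]

/-- Robbins' identity makes each summand `(x + 1) 1{X = x + 1} - b 1{X = x}` centred. The same
identity turns `(x + 1)² f(x + 1)` into `(x + 1) b f(x)`, so the variance is proportional to `f(x)`.
-/
lemma integral_sq_residual_le (hc : 0 ≤ c) (hπ : π (Set.Icc 0 c)ᶜ = 0) (x n : ℕ) :
    ∫ ω, ((x + 1) * count (obs ω) (x + 1) - bayesEstimator π x * count (obs ω) x) ^ 2
      ∂sampleLaw π n ≤ n * (marginal π x * (c * (x + 1 + c))) := by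
  obtain ⟨hb0, hbc⟩ := bayesEstimator_mem_Icc hc hπ x
  have hbf : (x + 1) * marginal π (x + 1) = bayesEstimator π x * marginal π x := by
    rw [bayesEstimator_mul_marginal, setIntegral_fst hπ]
  have hf0 : 0 ≤ marginal π x := marginal_nonneg x
  set b := bayesEstimator π x
  set g : ℕ → ℝ := fun k => (if k = x + 1 then (x + 1 : ℝ) else 0) - (if k = x then b else 0)
    with hg
  have hb : ∀ k, |g k| ≤ (x + 1) + b := fun k => by
    refine (abs_sub _ _).trans (add_le_add ?_ ?_)
    · split_ifs
      · rw [abs_of_nonneg (by positivity)]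
      · simp; positivity
    · split_ifs
      · rw [abs_of_nonneg hb0]
      · simpa using hb0
  have h0 : ∫ z, g z.2 ∂jointLaw π = 0 := by
    simp only [hg]
    rw [integral_sub (integrable_ite_snd _ _) (integrable_ite_snd _ _), integral_ite_snd,
      integral_ite_snd]
    linarith
  have h2 : ∫ z, g z.2 ^ 2 ∂jointLaw π =
      marginal π (x + 1) * (x + 1) ^ 2 + marginal π x * b ^ 2 := by
    have : ∀ z : ℝ × ℕ, g z.2 ^ 2 = (if z.2 = x + 1 then (x + 1 : ℝ) ^ 2 else 0) +
        (if z.2 = x then b ^ 2 else 0) := fun z => by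
      simp only [hg]
      split_ifs
      · omega
      · ring
      · ring
      · ring
    simp only [this]
    rw [integral_add (integrable_ite_snd _ _) (integrable_ite_snd _ _), integral_ite_snd,
      integral_ite_snd]
  have h3 := integral_sq_sum hb h0 n
  have h4 : ∀ ω : Fin n → ℝ × ℕ, ∑ j, g (obs ω j) =
      (x + 1) * count (obs ω) (x + 1) - b * count (obs ω) x := fun ω => by
    simp only [hg, count, Finset.sum_sub_distrib, Finset.mul_sum, mul_ite, mul_one, mul_zero]
  simp only [h4, h2] at h3
  rw [h3]
  gcongr
  calc marginal π (x + 1) * (x + 1) ^ 2 + marginal π x * b ^ 2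
      = ((x + 1) * marginal π (x + 1)) * (x + 1) + marginal π x * b ^ 2 := by ring
    _ = marginal π x * (b * (x + 1 + b)) := by rw [hbf]; ring
    _ ≤ marginal π x * (c * (x + 1 + c)) := by gcongr

/-- The clipped and regularized Robbins estimate at an observation `x`, computed from `x` and
the remaining observations `y`. -/
def robbins (r c : ℝ) {n : ℕ} (y : Fin n → ℕ) (x : ℕ) : ℝ :=
  min ((x + 1) * (r * count y (x + 1) / (r * (count y x + 1) + (n - count y x)))) c

lemma count_nonneg {n : ℕ} (y : Fin n → ℕ) (x : ℕ) : 0 ≤ count y x :=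
  Finset.sum_nonneg fun j _ => by split_ifs <;> simp

lemma count_le {n : ℕ} (y : Fin n → ℕ) (x : ℕ) : count y x ≤ n := by
  calc count y x ≤ ∑ j : Fin n, (1 : ℝ) :=
        Finset.sum_le_sum fun j _ => by split_ifs <;> simp
    _ = n := by simp

lemma robbins_mem_Icc {r : ℝ} (hr : 0 ≤ r) (hc : 0 ≤ c) {n : ℕ} (y : Fin n → ℕ) (x : ℕ) :
    robbins r c y x ∈ Set.Icc 0 c := by
  have h1 := count_nonneg y x
  have h2 := count_nonneg y (x + 1)
  have h3 : 0 ≤ (n : ℝ) - count y x := sub_nonneg.2 (count_le y x)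
  exact ⟨le_min (by positivity) hc, min_le_right _ _⟩

lemma integrable_comp_obs {n : ℕ} {F : (Fin n → ℕ) → ℝ} {C : ℝ} (hF : ∀ y, |F y| ≤ C) :
    Integrable (fun ω => F (obs ω)) (sampleLaw π n) :=
  Integrable.of_bound (Measurable.comp (g := F) .of_discrete measurable_obs).aestronglyMeasurable
    C (Eventually.of_forall fun _ => hF _)

lemma integrable_sq_comb_count {n : ℕ} (s t u : ℝ) (x z : ℕ) :
    Integrable (fun ω => (s * count (obs ω) x - t * count (obs ω) z - u) ^ 2)
      (sampleLaw π n) := by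
  refine integrable_comp_obs (F := fun y => (s * count y x - t * count y z - u) ^ 2)
    (C := (|s| * n + |t| * n + |u|) ^ 2) fun y => ?_
  rw [abs_pow]
  have h : ∀ k, |count y k| ≤ n := fun k => by
    rw [abs_of_nonneg (count_nonneg y k)]
    exact count_le y k
  gcongr
  refine (abs_sub _ _).trans (add_le_add_left ((abs_sub _ _).trans ?_) _)
  rw [abs_mul, abs_mul]
  gcongr <;> exact h _

/-- Every power of the marginal `f` cancels against the weight in front, so the bound does not
depend on the prior, however rare `x` is. -/
lemma marginal_mul_integral_sq_robbins_le (hc : 0 ≤ c) (hπ : π (Set.Icc 0 c)ᶜ = 0) {r : ℝ}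
    (hr : 1 ≤ r) (x : ℕ) {n : ℕ} (hn : 0 < n) :
    marginal π x * ∫ ω, (robbins r c (obs ω) x - bayesEstimator π x) ^ 2 ∂sampleLaw π n ≤
      8 * c * (x + 1 + 2 * c) / n + 4 * c ^ 2 / r := by
  have hn' : (0 : ℝ) < n := by exact_mod_cast hn
  have hr0 : 0 < r := by linarith
  rcases (marginal_nonneg (π := π) x).eq_or_lt with hf | hf
  · rw [← hf, zero_mul]
    positivity
  have hb := bayesEstimator_mem_Icc hc hπ x
  set f := marginal π x with hfdef
  set b := bayesEstimator π x with hbdef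
  have i1 : Integrable (fun ω => ((x + 1) * count (obs ω) (x + 1) - b * count (obs ω) x) ^ 2)
      (sampleLaw π n) := by
    simpa using integrable_sq_comb_count (π := π) (n := n) (x + 1) b 0 (x + 1) x
  have i2 : Integrable (fun ω => (count (obs ω) x - n * f) ^ 2) (sampleLaw π n) := by
    simpa using integrable_sq_comb_count (π := π) (n := n) 1 0 (n * f) x x
  have hle : ∫ ω, (robbins r c (obs ω) x - b) ^ 2 ∂sampleLaw π n ≤
      ∫ ω, (8 / (n * f) ^ 2 * ((x + 1) * count (obs ω) (x + 1) - b * count (obs ω) x) ^ 2 +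
        4 * c ^ 2 * (1 + n / r) / (n * f) +
        4 * c ^ 2 / (n * f) ^ 2 * (count (obs ω) x - n * f) ^ 2) ∂sampleLaw π n := by
    refine integral_mono ?_ (((i1.const_mul _).add (integrable_const _)).add (i2.const_mul _)) ?_
    · refine integrable_comp_obs (F := fun y => (robbins r c y x - b) ^ 2) (C := c ^ 2) fun y => ?_
      obtain ⟨h1, h2⟩ := robbins_mem_Icc hr0.le hc y x
      obtain ⟨h3, h4⟩ := hb
      rw [abs_of_nonneg (sq_nonneg _)]
      exact sq_le_sq' (by linarith) (by linarith)
    · intro _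
      exact sq_error_robbins_le (by positivity) hr (count_nonneg _ _) (count_nonneg _ _)
        (count_le _ _) hn' hb hf
  have heq : ∫ ω, (8 / (n * f) ^ 2 *
        ((x + 1) * count (obs ω) (x + 1) - b * count (obs ω) x) ^ 2 +
        4 * c ^ 2 * (1 + n / r) / (n * f) +
        4 * c ^ 2 / (n * f) ^ 2 * (count (obs ω) x - n * f) ^ 2) ∂sampleLaw π n =
      8 / (n * f) ^ 2 *
        (∫ ω, ((x + 1) * count (obs ω) (x + 1) - b * count (obs ω) x) ^ 2 ∂sampleLaw π n) +
        4 * c ^ 2 * (1 + n / r) / (n * f) +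
        4 * c ^ 2 / (n * f) ^ 2 * ∫ ω, (count (obs ω) x - n * f) ^ 2 ∂sampleLaw π n := by
    refine (integral_add ((i1.const_mul _).add (integrable_const _)) (i2.const_mul _)).trans ?_
    rw [integral_const_mul]
    congr 1
    refine (integral_add (i1.const_mul _) (integrable_const _)).trans ?_
    rw [integral_const_mul]
    simp
  have b1 := integral_sq_residual_le hc hπ x n
  have b2 := integral_sq_count_sub_le (π := π) x n
  calc f * ∫ ω, (robbins r c (obs ω) x - b) ^ 2 ∂sampleLaw π n
      ≤ f * (8 / (n * f) ^ 2 * (n * (f * (c * (x + 1 + c)))) +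
        4 * c ^ 2 * (1 + n / r) / (n * f) + 4 * c ^ 2 / (n * f) ^ 2 * (n * f)) := by
        refine mul_le_mul_of_nonneg_left ((hle.trans_eq heq).trans ?_) hf.le
        gcongr
    _ = 8 * c * (x + 1 + 2 * c) / n + 4 * c ^ 2 / r := by
        field_simp
        ring

/-- The output of the Robbins transformer at a token, as a function of the token and of the
other tokens. -/
def truncRobbins (K : ℕ) (r c : ℝ) {n : ℕ} (y : Fin n → ℕ) (x : ℕ) : ℝ :=
  if x < K then robbins r c y x else 0

lemma truncRobbins_mem_Icc {r : ℝ} (hr : 0 ≤ r) (hc : 0 ≤ c) (K : ℕ) {n : ℕ} (y : Fin n → ℕ)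
    (x : ℕ) : truncRobbins K r c y x ∈ Set.Icc 0 c := by
  unfold truncRobbins
  split_ifs
  · exact robbins_mem_Icc hr hc y x
  · exact ⟨le_rfl, hc⟩

lemma count_eq_add_succAbove {n : ℕ} (x : Fin (n + 1) → ℕ) (i : Fin (n + 1)) (y : ℕ) :
    count x y = (if x i = y then 1 else 0) + count (fun j => x (i.succAbove j)) y :=
  Fin.sum_univ_succAbove _ i

/-- The token at `i` adds `1` to the count of its own value, nothing to that of its successor, and
leaves `n - N` unchanged. The output thus depends on `X_i` and an independent sample. -/
lemma eval_eq_truncRobbins (K : ℕ) {r : ℝ} (hr : 0 < r) (hc : 0 ≤ c) {n : ℕ}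
    (x : Fin (n + 1) → ℕ) (i : Fin (n + 1)) :
    (robbinsTransformer K r c).eval x i =
      truncRobbins K r c (fun j => x (i.succAbove j)) (x i) := by
  rw [robbinsTransformer_eval K hr hc, truncRobbins, robbins]
  rw [count_eq_add_succAbove x i (x i), count_eq_add_succAbove x i (x i + 1), if_pos rfl,
    if_neg (by omega : ¬ x i = x i + 1)]
  rw [zero_add, add_comm (1 : ℝ)]
  push_cast
  rw [add_sub_add_right_eq_sub]

lemma sq_sub_mem_Icc {c t θ : ℝ} (ht : t ∈ Set.Icc 0 c) (hθ : θ ∈ Set.Icc 0 c) :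
    (t - θ) ^ 2 ∈ Set.Icc 0 (c ^ 2) := by
  obtain ⟨h1, h2⟩ := ht
  obtain ⟨h3, h4⟩ := hθ
  exact ⟨sq_nonneg _, sq_le_sq' (by linarith) (by linarith)⟩

/-- The regret of the Robbins transformer on a sample of size `n + 1`. -/
theorem regret_robbinsTransformer_le (hc : 0 ≤ c) (hπ : π (Set.Icc 0 c)ᶜ = 0) {r : ℝ}
    (hr : 1 ≤ r) (K : ℕ) {n : ℕ} (hn : 0 < n) (i : Fin (n + 1)) :
    Integrable (sqLoss (robbinsTransformer K r c).eval i) (sampleLaw π (n + 1)) ∧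
    regret π (robbinsTransformer K r c).eval i ≤
      K * (8 * c * (K + 2 * c) / n + 4 * c ^ 2 / r) +
        c ^ 2 * (Real.exp (-K) * Real.exp (Real.exp 1 * c)) := by
  have hr0 : 0 < r := by linarith
  set e := MeasurableEquiv.piFinSuccAbove (fun _ : Fin (n + 1) => ℝ × ℕ) i
  have he : MeasurePreserving e (sampleLaw π (n + 1)) ((jointLaw π).prod (sampleLaw π n)) :=
    measurePreserving_piFinSuccAbove (fun _ => jointLaw π) i
  set G : (ℝ × ℕ) × (Fin n → ℝ × ℕ) → ℝ :=
    fun p => (truncRobbins K r c (obs p.2) p.1.2 - p.1.1) ^ 2 with hG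
  have hloss : sqLoss (robbinsTransformer K r c).eval i = G ∘ e := by
    funext ω
    rw [sqLoss, eval_eq_truncRobbins K hr0 hc]
    rfl
  have hGm : Measurable G := by
    have h1 : Measurable fun p : (ℝ × ℕ) × (Fin n → ℝ × ℕ) => (p.1.2, obs p.2) :=
      (measurable_snd.comp measurable_fst).prodMk (measurable_obs.comp measurable_snd)
    have h2 : Measurable fun q : ℕ × (Fin n → ℕ) => truncRobbins K r c q.2 q.1 := .of_discrete
    exact ((h2.comp h1).sub (measurable_fst.comp measurable_fst)).pow_const 2
  have hGi : Integrable G ((jointLaw π).prod (sampleLaw π n)) := by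
    refine Integrable.of_mem_Icc 0 (c ^ 2) hGm.aemeasurable ?_
    have : ∀ᵐ p ∂(jointLaw π).prod (sampleLaw π n), p.1.1 ∈ Set.Icc 0 c :=
      Measure.quasiMeasurePreserving_fst.ae (ae_jointLaw_fst_mem_Icc hπ)
    filter_upwards [this] with p hp
    exact sq_sub_mem_Icc (truncRobbins_mem_Icc hr0.le hc K _ _) hp
  refine ⟨?_, ?_⟩
  · rw [hloss]
    exact he.integrable_comp_of_integrable hGi
  have hint : ∫ ω, sqLoss (robbinsTransformer K r c).eval i ω ∂sampleLaw π (n + 1) =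
      ∫ ω, ∫ z, G (z, ω) ∂jointLaw π ∂sampleLaw π n := by
    rw [hloss, ← integral_prod_symm G hGi]
    exact he.integral_comp' G
  set R := c ^ 2 * (Real.exp (-K) * Real.exp (Real.exp 1 * c)) with hR
  have hsi : ∀ x ∈ Finset.range K, Integrable
      (fun ω => marginal π x * (robbins r c (obs ω) x - bayesEstimator π x) ^ 2)
      (sampleLaw π n) := fun x _ => by
    refine Integrable.const_mul (integrable_comp_obs
      (F := fun y => (robbins r c y x - bayesEstimator π x) ^ 2) (C := c ^ 2) fun y => ?_) _
    obtain ⟨h1, h2⟩ := sq_sub_mem_Icc (robbins_mem_Icc hr0.le hc y x)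
      (bayesEstimator_mem_Icc hc hπ x)
    rwa [abs_of_nonneg h1]
  have hle : ∫ ω, ∫ z, G (z, ω) ∂jointLaw π ∂sampleLaw π n ≤
      ∫ ω, (∑ x ∈ Finset.range K,
        marginal π x * (robbins r c (obs ω) x - bayesEstimator π x) ^ 2 + (mmse π + R))
        ∂sampleLaw π n := by
    refine integral_mono hGi.integral_prod_right
      ((integrable_finsetSum _ hsi).add (integrable_const _)) fun ω => ?_
    -- With the other observations frozen, the output is a fixed `[0, c]`-valued function of `X_i`,
    -- so the decomposition and the truncation apply for each `ω`.
    have ht := truncRobbins_mem_Icc hr0.le hc K (obs ω)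
    have h1 := integral_sq_sub_fst hc hπ ht
    have h2 := integral_sq_sub_bayesEstimator_le hc hπ ht K
    have h3 : ∑ x ∈ Finset.range K,
        marginal π x * (truncRobbins K r c (obs ω) x - bayesEstimator π x) ^ 2 =
        ∑ x ∈ Finset.range K,
        marginal π x * (robbins r c (obs ω) x - bayesEstimator π x) ^ 2 :=
      Finset.sum_congr rfl fun x hx => by rw [truncRobbins, if_pos (Finset.mem_range.1 hx)]
    simp only [hG]
    linarith
  rw [integral_add (integrable_finsetSum _ hsi) (integrable_const _),
    integral_finsetSum _ hsi] at hle
  have hsum : ∑ x ∈ Finset.range K, ∫ ω, marginal π x *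
      (robbins r c (obs ω) x - bayesEstimator π x) ^ 2 ∂sampleLaw π n ≤
      K * (8 * c * (K + 2 * c) / n + 4 * c ^ 2 / r) := by
    calc _ ≤ ∑ x ∈ Finset.range K, (8 * c * (K + 2 * c) / n + 4 * c ^ 2 / r) := by
          refine Finset.sum_le_sum fun x hx => ?_
          rw [integral_const_mul]
          refine (marginal_mul_integral_sq_robbins_le hc hπ hr x hn).trans ?_
          have : (x : ℝ) + 1 ≤ K := by exact_mod_cast Finset.mem_range.1 hx
          gcongr
      _ = _ := by rw [Finset.sum_const, Finset.card_range, nsmul_eq_mul]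
  have hconst : ∫ _, (mmse π + R) ∂sampleLaw π n = mmse π + R := by simp
  rw [hconst] at hle
  rw [regret, hint]
  linarith

end Risk

end PoissonEB

end

noncomputable section

namespace PoissonEB

/-! ### Choice of the parameters -/

/-- The number of tokens for which the transformer computes a nontrivial estimate. -/
def cutoff (c ε : ℝ) : ℕ := ⌈Real.log (3 * (c ^ 2 * Real.exp (Real.exp 1 * c)) / ε)⌉₊ + 1

/-- The relative attention weight of equal tokens. -/
def attentionRatio (c ε : ℝ) : ℝ := 1 + 12 * c ^ 2 * cutoff c ε / ε

/-- The smallest admissible sample size. -/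
def minSampleSize (c ε : ℝ) : ℕ := ⌈24 * c * cutoff c ε * (cutoff c ε + 2 * c) / ε⌉₊ + 2

/-- Tail, variance and regularization bias each receive a budget of `ε / 3`; this fixes the
constants `3`, `24 = 3 · 8` and `12 = 3 · 4` in the parameters. -/
lemma regret_bound_le {c ε : ℝ} (hc : 0 < c) (hε : 0 < ε) {n : ℕ}
    (hn : minSampleSize c ε ≤ n + 1) :
    cutoff c ε * (8 * c * (cutoff c ε + 2 * c) / n + 4 * c ^ 2 / attentionRatio c ε) +
      c ^ 2 * (Real.exp (-cutoff c ε) * Real.exp (Real.exp 1 * c)) ≤ ε := by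
  have hK : (1 : ℝ) ≤ cutoff c ε := by simp [cutoff]
  have hn' : 24 * c * cutoff c ε * (cutoff c ε + 2 * c) / ε ≤ n := by
    refine (Nat.le_ceil _).trans ?_
    have : ⌈24 * c * cutoff c ε * (cutoff c ε + 2 * c) / ε⌉₊ ≤ n := by
      unfold minSampleSize at hn
      omega
    exact_mod_cast this
  have hA : 0 < c ^ 2 * Real.exp (Real.exp 1 * c) := by positivity
  have htail : c ^ 2 * (Real.exp (-cutoff c ε) * Real.exp (Real.exp 1 * c)) ≤ ε / 3 := by
    have h1 : Real.log (3 * (c ^ 2 * Real.exp (Real.exp 1 * c)) / ε) ≤ cutoff c ε := by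
      refine (Nat.le_ceil _).trans ?_
      exact_mod_cast Nat.le_succ _
    have h2 := (Real.log_le_iff_le_exp (by positivity)).1 h1
    rw [Real.exp_neg]
    rw [div_le_iff₀ hε] at h2
    have h3 := Real.exp_pos (cutoff c ε : ℝ)
    rw [← mul_assoc, mul_comm (c ^ 2), mul_assoc, inv_mul_le_iff₀ h3]
    linarith
  set K : ℝ := (cutoff c ε : ℝ) with hKdef
  have hn0 : 0 < (n : ℝ) := lt_of_lt_of_le (by positivity) hn'
  have hvar : K * (8 * c * (K + 2 * c) / n) ≤ ε / 3 := by
    rw [div_le_iff₀ hε] at hn'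
    rw [← mul_div_assoc, div_le_iff₀ hn0]
    linarith
  have hbias : K * (4 * c ^ 2 / attentionRatio c ε) ≤ ε / 3 := by
    have hr : 0 < attentionRatio c ε := by unfold attentionRatio; positivity
    have : attentionRatio c ε * ε = ε + 12 * c ^ 2 * K := by
      rw [attentionRatio, ← hKdef]
      field_simp
    rw [← mul_div_assoc, div_le_iff₀ hr]
    linarith
  linarith

/-! ### Asymptotics as `ε → 0⁺` -/

lemma one_le_log_inv {ε : ℝ} (hε : ε ∈ Set.Ioo 0 (Real.exp (-1))) : 1 ≤ Real.log ε⁻¹ := by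
  rw [Real.log_inv]
  have := (Real.log_lt_iff_lt_exp hε.1).2 hε.2
  linarith

lemma exists_cutoff_le_log {c : ℝ} (hc : 0 < c) :
    ∃ B : ℝ, 0 < B ∧ ∀ ε ∈ Set.Ioo 0 (Real.exp (-1)), (cutoff c ε : ℝ) ≤ B * Real.log ε⁻¹ := by
  set A := 3 * (c ^ 2 * Real.exp (Real.exp 1 * c)) with hA
  have hA0 : 0 < A := by positivity
  refine ⟨|Real.log A| + 3, by positivity, fun ε hε => ?_⟩
  have hL := one_le_log_inv hε
  have h1 : Real.log (A / ε) = Real.log A + Real.log ε⁻¹ := by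
    rw [div_eq_mul_inv, Real.log_mul hA0.ne' (inv_pos.2 hε.1).ne']
  have h2 : (⌈Real.log (A / ε)⌉₊ : ℝ) ≤ (|Real.log A| + Real.log ε⁻¹) + 1 := by
    refine (Nat.cast_le.2 (Nat.ceil_mono ?_)).trans (Nat.ceil_lt_add_one ?_).le
    · rw [h1]
      linarith [le_abs_self (Real.log A)]
    · positivity
  have h3 : |Real.log A| ≤ |Real.log A| * Real.log ε⁻¹ :=
    le_mul_of_one_le_right (abs_nonneg _) hL
  rw [cutoff, ← hA]
  push_cast
  linarith

/-- On this interval `ε⁻¹` and `log ε⁻¹` are at least `1`, so additive constants can be absorbed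
into multiplicative ones. -/
lemma eventually_mem_Ioo : ∀ᶠ ε : ℝ in 𝓝[>] 0, ε ∈ Set.Ioo 0 (Real.exp (-1)) :=
  Ioo_mem_nhdsGT (Real.exp_pos _)

lemma one_le_inv {ε : ℝ} (hε : ε ∈ Set.Ioo 0 (Real.exp (-1))) : 1 ≤ ε⁻¹ :=
  (one_le_inv₀ hε.1).2 (hε.2.le.trans (Real.exp_le_one_iff.2 (by norm_num)))

lemma minSampleSize_isBigO {c : ℝ} (hc : 0 < c) :
    (fun ε : ℝ => (minSampleSize c ε : ℝ)) =O[𝓝[>] 0]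
      fun ε : ℝ => ε⁻¹ * Real.log ε⁻¹ ^ 2 := by
  obtain ⟨B, hB, hK⟩ := exists_cutoff_le_log hc
  refine IsBigO.of_bound (24 * c * B * (B + 2 * c) + 3) ?_
  filter_upwards [eventually_mem_Ioo] with ε hε
  have hL := one_le_log_inv hε
  have hi := one_le_inv hε
  have hKε := hK ε hε
  set L := Real.log ε⁻¹
  have h1 : 24 * c * cutoff c ε * (cutoff c ε + 2 * c) / ε ≤
      24 * c * B * (B + 2 * c) * (ε⁻¹ * L ^ 2) := by
    have h2 : (cutoff c ε + 2 * c : ℝ) ≤ (B + 2 * c) * L := by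
      have : 2 * c ≤ 2 * c * L := le_mul_of_one_le_right (by positivity) hL
      linarith
    calc _ ≤ 24 * c * (B * L) * ((B + 2 * c) * L) / ε := by
          have := hε.1
          gcongr
      _ = _ := by rw [div_eq_mul_inv]; ring
  have h3 : (minSampleSize c ε : ℝ) ≤
      24 * c * cutoff c ε * (cutoff c ε + 2 * c) / ε + 3 := by
    rw [minSampleSize]
    push_cast
    have := Nat.ceil_lt_add_one (a := 24 * c * cutoff c ε * (cutoff c ε + 2 * c) / ε)
      (div_nonneg (by positivity) hε.1.le)
    linarith
  have h4 : 1 ≤ ε⁻¹ * L ^ 2 := one_le_mul_of_one_le_of_one_le hi (one_le_pow₀ hL)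
  rw [Real.norm_of_nonneg (Nat.cast_nonneg _), Real.norm_of_nonneg (by linarith)]
  linarith

lemma numParams_isBigO {c : ℝ} (hc : 0 < c) (r : ℝ → ℝ) :
    (fun ε : ℝ => ((robbinsTransformer (cutoff c ε) (r ε) c).numParams : ℝ)) =O[𝓝[>] 0]
      fun ε : ℝ => ε⁻¹ := by
  obtain ⟨B, hB, hK⟩ := exists_cutoff_le_log hc
  refine IsBigO.of_bound (50 * (B + 1) ^ 2 * 4) ?_
  filter_upwards [eventually_mem_Ioo] with ε hε
  have hL := one_le_log_inv hε
  have hi := one_le_inv hε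
  have hKε := hK ε hε
  -- From `log y = 2 log √y ≤ 2 √y`.
  have hsq : Real.log ε⁻¹ ^ 2 ≤ 4 * ε⁻¹ := by
    have h1 : Real.log ε⁻¹ ≤ 2 * Real.sqrt ε⁻¹ := by
      have h2 := Real.log_le_self (Real.sqrt_nonneg ε⁻¹)
      rw [Real.log_sqrt (by linarith)] at h2
      linarith
    calc Real.log ε⁻¹ ^ 2 ≤ (2 * Real.sqrt ε⁻¹) ^ 2 := by gcongr
      _ = 4 * ε⁻¹ := by rw [mul_pow, Real.sq_sqrt (by linarith)]; norm_num
  have hp : ((robbinsTransformer (cutoff c ε) (r ε) c).numParams : ℝ) ≤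
      50 * (cutoff c ε + 1) ^ 2 := by
    exact_mod_cast numParams_robbinsTransformer (cutoff c ε) (r ε) c
  rw [Real.norm_of_nonneg (Nat.cast_nonneg _), Real.norm_of_nonneg (by linarith)]
  calc _ ≤ 50 * (cutoff c ε + 1 : ℝ) ^ 2 := hp
    _ ≤ 50 * ((B + 1) * Real.log ε⁻¹) ^ 2 := by
        gcongr
        linarith
    _ = 50 * (B + 1) ^ 2 * Real.log ε⁻¹ ^ 2 := by ring
    _ ≤ 50 * (B + 1) ^ 2 * (4 * ε⁻¹) := by gcongr
    _ = _ := by ring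

end PoissonEB

end

theorem mainTheorem3 (θmax : ℝ) (hθmax : 0 < θmax) :
    ∃ (N : ℝ → ℕ) (Γ : ℝ → PoissonEB.Transformer),
      (fun ε : ℝ => (N ε : ℝ)) =O[𝓝[>] 0] (fun ε : ℝ => ε⁻¹ * Real.log ε⁻¹ ^ 2) ∧
      (fun ε : ℝ => ((Γ ε).numParams : ℝ)) =O[𝓝[>] 0] (fun ε : ℝ => ε⁻¹) ∧
      ∀ ε : ℝ, 0 < ε → ∀ n : ℕ, N ε ≤ n →
        ∀ π : Measure ℝ, IsProbabilityMeasure π → π (Set.Icc 0 θmax)ᶜ = 0 →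
          ∀ i : Fin n,
            Integrable (PoissonEB.sqLoss (Γ ε).eval i) (PoissonEB.sampleLaw π n) ∧
            PoissonEB.regret π (Γ ε).eval i ≤ ε := by
  refine ⟨PoissonEB.minSampleSize θmax, fun ε => PoissonEB.robbinsTransformer
    (PoissonEB.cutoff θmax ε) (PoissonEB.attentionRatio θmax ε) θmax,
    PoissonEB.minSampleSize_isBigO hθmax, PoissonEB.numParams_isBigO hθmax _, ?_⟩
  intro ε hε n hn π _ hπ i
  -- An index `i : Fin n` forces `n ≥ 1`; the `m` other observations form the independent sample.
  -- The summand `2` in `minSampleSize` ensures `m > 0`.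
  obtain ⟨m, rfl⟩ : ∃ m, n = m + 1 := ⟨n - 1, by have := i.pos; omega⟩
  have hm : 0 < m := by
    unfold PoissonEB.minSampleSize at hn
    omega
  have hr : 1 ≤ PoissonEB.attentionRatio θmax ε := by
    unfold PoissonEB.attentionRatio
    exact le_add_of_nonneg_right (by positivity)
  obtain ⟨h1, h2⟩ := PoissonEB.regret_robbinsTransformer_le hθmax.le hπ hr
    (PoissonEB.cutoff θmax ε) hm i
  exact ⟨h1, h2.trans (PoissonEB.regret_bound_le hθmax hε hn)⟩
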